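/- Let $k\ge 2$ be an integer and let $\alpha\in\left(\frac1{k+1},\frac1k\right)$. Then there exists a constant $0<c<1$, depending only on $k$ and $\alpha$, such that the following holds. For each $n$ let $H_\alpha=H_{\alpha,n}$ be a complete bipartite graph on the vertex set $\{1,\dots,n\}$ with vertex classes $A$ and $B$ of sizes $\alpha n$ and $(1-\alpha)n$, where for each $n$ the number $\alpha n$ is rounded up or down to an integer $|A|$ and $|B|=n-|A|$. Let $p=p(n)\in[0,1]$ satisfy $$p\le c\,n^{-(k-1)/(2k-3)}$$ for all sufficiently large $n$, and let $G(n,p)$ be the binomial random graph on $\{1,\dots,n\}$, in which each pair of vertices is an edge independently with probability $p$. Then $$\lim_{n\to\infty}\mathbb P\big(H_\alpha\cup G(n,p)\text{ does not contain a copy of } C_n^2\big)=1,$$ where $C_n^2$, the square of the cycle $C_n$ on $n$ vertices, is the graph obtained from $C_n$ by adding an edge between every two vertices at distance two in $C_n$. -/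

import Mathlib

open Filter Topology

namespace PerturbedSquare

/-- The `r`-th power of a graph: two distinct vertices are adjacent iff their distance in `G` is at
most `r`. (`edist` is the graph distance, with value `⊤` for vertices in different components.) -/
def graphPower {V : Type*} (G : SimpleGraph V) (r : ℕ) : SimpleGraph V where
  Adj u v := u ≠ v ∧ G.edist u v ≤ (r : ℕ∞)
  symm := ⟨fun u v h => ⟨h.1.symm, by rw [SimpleGraph.edist_comm]; exact h.2⟩⟩
  loopless := ⟨fun _ h => h.1 rfl⟩

/-- The square of the cycle on `n` vertices. -/
def squareCycle (n : ℕ) : SimpleGraph (Fin n) :=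
  graphPower (SimpleGraph.cycleGraph n) 2

/-- The complete bipartite graph on the vertex set `V` with vertex classes `A` and `V \ A`. -/
def completeBipartiteOn {V : Type*} (A : Finset V) : SimpleGraph V :=
  (⊤ : SimpleGraph V).between (A : Set V) (A : Set V)ᶜ

end PerturbedSquare

open MeasureTheory ProbabilityTheory SimpleGraph

namespace PerturbedSquare

/-! Cut the squared cycle into ⌊n/k⌋ blocks of k consecutive vertices, each spanning a squared path.
At most |A| blocks meet A, so m = ⌊n/k⌋ - |A| of them lie in B, and m grows linearly because α <
1/k. All edges inside B are random, so G(n,p) contains m disjoint squared paths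
(`exists_isSeparated_of_isContained`), each with at least 2k-3 edges. By the union bound
(`binomialRandom_exists_isSeparated_le`) this has probability at most (n^k p^(2k-3))^m / m! ≤ (cn)^m
/ m!, which is at most 4^(-m) for small c. -/

/-- A family of maps from `W` to `V` is separated if its members are injective and have pairwise
disjoint ranges. -/
def IsSeparated {W V : Type*} (S : Finset (W → V)) : Prop :=
  (∀ s ∈ S, Function.Injective s) ∧ ∀ s ∈ S, ∀ t ∈ S, s ≠ t → ∀ i j, s i ≠ t j

/-- The square of the path on `k` vertices. -/
def squarePath (k : ℕ) : SimpleGraph (Fin k) where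
  Adj i j := i ≠ j ∧ (i : ℕ) ≤ j + 2 ∧ (j : ℕ) ≤ i + 2
  symm := ⟨fun _ _ h => ⟨h.1.symm, h.2.2, h.2.1⟩⟩
  loopless := ⟨fun _ h => h.1 rfl⟩

theorem le_ncard_edgeSet_squarePath {k : ℕ} (hk : 2 ≤ k) :
    2 * k - 3 ≤ (squarePath k).edgeSet.ncard := by
  let g : Fin (k - 1) ⊕ Fin (k - 2) → Sym2 (Fin k) := Sum.elim
    (fun i => s(⟨i, by omega⟩, ⟨i + 1, by omega⟩)) (fun i => s(⟨i, by omega⟩, ⟨i + 2, by omega⟩))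
  have hg : Function.Injective g := by
    rintro (i | i) (j | j) h <;>
      simp only [g, Sum.elim_inl, Sum.elim_inr, Sym2.eq_iff, Fin.mk.injEq] at h
    · exact congrArg Sum.inl (Fin.ext (by omega))
    · omega
    · omega
    · exact congrArg Sum.inr (Fin.ext (by omega))
  have hsub : Set.range g ⊆ (squarePath k).edgeSet := by
    rintro _ ⟨i | i, rfl⟩ <;> simp [g, squarePath] <;> omega
  calc 2 * k - 3 = (Set.range g).ncard := by
        rw [Set.ncard_range_of_injective hg]
        simp
        omega
    _ ≤ _ := Set.ncard_le_ncard hsub (Set.toFinite _)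

/-- The probability that a given set of pairs consists of edges of the binomial random graph. -/
theorem binomialRandom_subset_edgeSet_le {V : Type*} [Countable V] (p : unitInterval)
    (T : Finset (Sym2 V)) :
    binomialRandom V p {G | (T : Set (Sym2 V)) ⊆ G.edgeSet}
      ≤ (unitInterval.toNNReal p : ENNReal) ^ T.card := by
  rw [binomialRandom_apply']
  calc _ ≤ setBernoulli (Sym2.diagSetᶜ : Set (Sym2 V)) p {s | (T : Set (Sym2 V)) ⊆ s} := by
        refine measure_mono ?_
        rintro _ ⟨G, hG, rfl⟩
        exact hG
    _ = Measure.infinitePi (fun e : Sym2 V => unitInterval.toNNReal p •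
          Measure.dirac (e ∈ (Sym2.diagSetᶜ : Set (Sym2 V)))
          + unitInterval.toNNReal (unitInterval.symm p) • Measure.dirac False)
          (Set.pi T fun _ => {True}) := by
        rw [setBernoulli_apply']
        congr 1
        ext s
        simp [Set.subset_def, Set.mem_pi]
    _ ≤ _ := by
        rw [Measure.infinitePi_pi _ (fun _ _ => MeasurableSet.of_discrete), ← Finset.prod_const]
        refine Finset.prod_le_prod' fun e _ => ?_
        simp only [Measure.coe_add, Pi.add_apply, Measure.smul_apply]
        -- A diagonal pair contributes 0 and any other pair p, so loops in `T` do no harm.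
        by_cases h : e ∈ (Sym2.diagSetᶜ : Set (Sym2 V)) <;> simp_all

/-- Union bound for vertex-disjoint copies of `F` in the binomial random graph. -/
theorem binomialRandom_exists_isSeparated_le {V W : Type*} [Fintype V] [Fintype W]
    (F : SimpleGraph W) (p : unitInterval) (m : ℕ) :
    binomialRandom V p {G | ∃ S : Finset (W → V), S.card = m ∧ IsSeparated S ∧
        ∀ s ∈ S, ∀ i j, F.Adj i j → G.Adj (s i) (s j)}
      ≤ ((Fintype.card V ^ Fintype.card W).choose m : ENNReal)
        * (unitInterval.toNNReal p : ENNReal) ^ (F.edgeSet.ncard * m) := by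
  classical
  let E : Finset (W → V) → Finset (Sym2 V) := fun S =>
    S.biUnion fun s => F.edgeFinset.image (Sym2.map s)
  -- Injectivity keeps the edges within a copy distinct; disjoint ranges prevent two copies from
  -- sharing an edge.
  have hE : ∀ S, IsSeparated S → (E S).card = F.edgeSet.ncard * S.card := by
    intro S hS
    rw [Finset.card_biUnion]
    · rw [Finset.sum_congr rfl (fun s hs =>
        Finset.card_image_of_injective _ (Sym2.map.injective (hS.1 s hs)))]
      rw [Finset.sum_const, smul_eq_mul, mul_comm, ← coe_edgeFinset, Set.ncard_coe_finset]
    · intro s hs t ht hst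
      rw [Function.onFun, Finset.disjoint_left]
      intro e he he'
      obtain ⟨a, -, rfl⟩ := Finset.mem_image.1 he
      obtain ⟨b, -, hb⟩ := Finset.mem_image.1 he'
      induction a with | _ x y =>
      have hx : s x ∈ Sym2.map t b := by rw [hb]; simp
      obtain ⟨z, -, hz⟩ := Sym2.mem_map.1 hx
      exact hS.2 s hs t ht hst x z hz.symm
  let P := (Finset.powersetCard m (Finset.univ : Finset (W → V))).filter IsSeparated
  calc _ ≤ binomialRandom V p (⋃ S ∈ P, {G | (E S : Set (Sym2 V)) ⊆ G.edgeSet}) := by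
        refine measure_mono ?_
        rintro G ⟨S, hSm, hS, hSG⟩
        simp only [Set.mem_iUnion]
        refine ⟨S, by simp [P, hSm, hS], ?_⟩
        intro e he
        obtain ⟨s, hs, he⟩ := Finset.mem_biUnion.1 (Finset.mem_coe.1 he)
        obtain ⟨a, ha, rfl⟩ := Finset.mem_image.1 he
        induction a with | _ x y =>
        exact hSG s hs x y (by simpa using ha)
    _ ≤ ∑ S ∈ P, binomialRandom V p {G | (E S : Set (Sym2 V)) ⊆ G.edgeSet} :=
        measure_biUnion_finset_le _ _
    _ ≤ ∑ _S ∈ P, (unitInterval.toNNReal p : ENNReal) ^ (F.edgeSet.ncard * m) := by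
        refine Finset.sum_le_sum fun S hS => ?_
        simp only [P, Finset.mem_filter, Finset.mem_powersetCard] at hS
        rw [← hS.1.2, ← hE S hS.2]
        exact binomialRandom_subset_edgeSet_le p _
    _ ≤ _ := by
        rw [Finset.sum_const, nsmul_eq_mul]
        gcongr
        refine (Finset.card_filter_le _ _).trans ?_
        rw [Finset.card_powersetCard, Finset.card_univ, Fintype.card_fun]

theorem squareCycle_adj_of_le {n : ℕ} {u v : Fin n} (h : (u : ℕ) < v) (h' : (v : ℕ) ≤ u + 2) :
    (squareCycle n).Adj u v := by
  have hpath : ∀ a b : Fin n, (a : ℕ) + 1 = b → (cycleGraph n).Adj a b := fun a b hab =>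
    pathGraph_le_cycleGraph (pathGraph_adj.2 (Or.inl hab))
  refine ⟨fun huv => by simp [huv] at h, ?_⟩
  obtain hv | hv : (u : ℕ) + 1 = v ∨ (u : ℕ) + 2 = v := by omega
  · refine (Walk.edist_le (Walk.cons (hpath u v hv) Walk.nil)).trans ?_
    norm_num
  · have hw : (u : ℕ) + 1 < n := by omega
    refine (Walk.edist_le (Walk.cons (hpath u ⟨u + 1, hw⟩ rfl)
      (Walk.cons (hpath ⟨u + 1, hw⟩ v hv) Walk.nil))).trans ?_
    norm_num

/-- A copy of the square of the cycle on top of a complete bipartite graph with a small class `A`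
forces many disjoint copies of the square of a path in the added graph: cut the cycle into blocks
and keep those that avoid `A`. -/
theorem exists_isSeparated_of_isContained {n k : ℕ} (A : Finset (Fin n)) (G : SimpleGraph (Fin n))
    (hk : 0 < k) (h : (squareCycle n).IsContained (completeBipartiteOn A ⊔ G)) :
    ∃ S : Finset (Fin k → Fin n), S.card = n / k - A.card ∧ IsSeparated S ∧
      ∀ s ∈ S, ∀ i j, (squarePath k).Adj i j → G.Adj (s i) (s j) := by
  classical
  obtain ⟨f, hf⟩ := h
  -- Block `j` takes positions `k * j + i`; the last `n % k` positions are discarded, and no block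
  -- wraps around.
  let b : Fin (n / k) → Fin k → Fin n := fun j i =>
    f (Fin.castLE (Nat.div_mul_le_self n k) (finProdFinEquiv (j, i)))
  have hb : ∀ j i j' i', b j i = b j' i' → j = j' ∧ i = i' := by
    intro j i j' i' hij
    have := finProdFinEquiv.injective (Fin.castLE_injective _ (hf hij))
    simpa using this
  let bad : Finset (Fin (n / k)) := Finset.univ.filter fun j => ∃ i, b j i ∈ A
  have hbad : bad.card ≤ A.card := by
    -- Each bad block selects a vertex of `A`; disjointness of blocks makes this injective.
    have hex : ∀ j : Fin (n / k), ∃ v, j ∈ bad → ∃ i, b j i = v ∧ v ∈ A := by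
      intro j
      by_cases hj : j ∈ bad
      · obtain ⟨i, hi⟩ := (Finset.mem_filter.1 hj).2
        exact ⟨b j i, fun _ => ⟨i, rfl, hi⟩⟩
      · exact ⟨b j ⟨0, hk⟩, fun h => absurd h hj⟩
    choose v hv using hex
    refine Finset.card_le_card_of_injOn v (fun j hj => (hv j hj).choose_spec.2) ?_
    intro j hj j' hj' hjj
    obtain ⟨i, hi, -⟩ := hv j hj
    obtain ⟨i', hi', -⟩ := hv j' hj'
    exact (hb j i j' i' (by rw [hi, hi', hjj])).1
  have hgood : n / k - A.card ≤ badᶜ.card := by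
    rw [Finset.card_compl, Fintype.card_fin]
    omega
  obtain ⟨J, hJ, hJm⟩ := Finset.exists_subset_card_eq hgood
  have hbinj : Function.Injective b := fun j j' hjj =>
    (hb j ⟨0, hk⟩ j' ⟨0, hk⟩ (congrFun hjj _)).1
  refine ⟨J.image b, by rw [Finset.card_image_of_injective _ hbinj, hJm], ⟨?_, ?_⟩, ?_⟩
  · simp only [Finset.mem_image]
    rintro _ ⟨j, -, rfl⟩ i i' hii
    exact (hb _ _ _ _ hii).2
  · simp only [Finset.mem_image]
    rintro _ ⟨j, -, rfl⟩ _ ⟨j', -, rfl⟩ hne i i' hii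
    exact hne (congrArg b (hb _ _ _ _ hii).1)
  · simp only [Finset.mem_image]
    rintro _ ⟨j, hj, rfl⟩ i i' hii
    have hA : ∀ i, b j i ∉ A := by
      have := hJ hj
      simpa [bad] using this
    have hadj : ∀ i i' : Fin k, (i : ℕ) < i' → (i' : ℕ) ≤ i + 2 → G.Adj (b j i) (b j i') := by
      intro i i' h1 h2
      have hc := f.map_adj (squareCycle_adj_of_le
        (u := Fin.castLE (Nat.div_mul_le_self n k) (finProdFinEquiv (j, i)))
        (v := Fin.castLE (Nat.div_mul_le_self n k) (finProdFinEquiv (j, i')))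
        (by simpa using h1) (by simp; omega))
      rcases hc with hc | hc
      · exfalso
        rcases (between_adj.1 hc).2 with ⟨h, -⟩ | ⟨-, h⟩
        · exact hA i h
        · exact hA i' h
      · exact hc
    obtain ⟨hne, h1, h2⟩ := hii
    rcases lt_or_gt_of_ne (Fin.val_ne_of_ne hne) with h | h
    · exact hadj i i' h h2
    · exact (hadj i' i h h1).symm

/-- The exponent of the threshold is the one leaving n^(k-(k-1)) = n; then c^(2k-3) ≤ c since 2k-3 ≥
1. -/
theorem pow_mul_pow_le_of_le_rpow {k n : ℕ} (hk : 2 ≤ k) (hn : 0 < n) {c p : ℝ} (hc0 : 0 ≤ c)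
    (hc1 : c ≤ 1) (hp0 : 0 ≤ p)
    (hp : p ≤ c * (n : ℝ) ^ (-(((k : ℝ) - 1) / (2 * (k : ℝ) - 3)))) :
    (n : ℝ) ^ k * p ^ (2 * k - 3) ≤ c * n := by
  have hn' : (0 : ℝ) < n := by exact_mod_cast hn
  have hk' : (2 : ℝ) ≤ k := by exact_mod_cast hk
  have hcast : ((2 * k - 3 : ℕ) : ℝ) = 2 * k - 3 := by
    rw [Nat.cast_sub (by omega)]
    push_cast
    ring
  calc (n : ℝ) ^ k * p ^ (2 * k - 3)
      ≤ (n : ℝ) ^ k * (c * (n : ℝ) ^ (-(((k : ℝ) - 1) / (2 * (k : ℝ) - 3)))) ^ (2 * k - 3) := by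
        gcongr
    _ = c ^ (2 * k - 3) * ((n : ℝ) ^ (k : ℝ) * (n : ℝ) ^ (-((k : ℝ) - 1))) := by
        rw [mul_pow, ← Real.rpow_mul_natCast hn'.le, hcast, Real.rpow_natCast]
        rw [show -(((k : ℝ) - 1) / (2 * (k : ℝ) - 3)) * (2 * k - 3) = -((k : ℝ) - 1) by
          have : 2 * (k : ℝ) - 3 ≠ 0 := by linarith
          rw [neg_mul, div_mul_cancel₀ _ this]]
        ring
    _ = c ^ (2 * k - 3) * n := by
        rw [← Real.rpow_add hn']
        simp
    _ ≤ c * n := by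
        gcongr
        exact pow_le_of_le_one hc0 hc1 (by omega)

/-- From m^m / m! ≤ e^m and e/12 < 1/4. -/
theorem pow_div_factorial_le {m : ℕ} {x : ℝ} (hx0 : 0 ≤ x) (hx : x ≤ m / 12) :
    x ^ m / (m.factorial : ℝ) ≤ (1 / 4) ^ m := by
  have hfac : (0 : ℝ) < m.factorial := by exact_mod_cast m.factorial_pos
  calc x ^ m / (m.factorial : ℝ) ≤ (m / 12) ^ m / (m.factorial : ℝ) := by gcongr
    _ = (m : ℝ) ^ m / m.factorial * (1 / 12) ^ m := by
        rw [div_eq_mul_one_div (m : ℝ) 12, mul_pow]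
        ring
    _ ≤ Real.exp m * (1 / 12) ^ m := by
        gcongr
        exact Real.pow_div_factorial_le_exp _ (Nat.cast_nonneg m) m
    _ = (Real.exp 1 * (1 / 12)) ^ m := by rw [mul_pow, ← Real.exp_nat_mul, mul_one]
    _ ≤ (1 / 4) ^ m := by
        gcongr
        linarith [Real.exp_one_lt_three]

theorem binomialRandom_squareCycle_isContained_le {k n : ℕ} (hk : 2 ≤ k) (hn : 0 < n) {c : ℝ}
    (hc0 : 0 ≤ c) (hc1 : c ≤ 1) (A : Finset (Fin n)) (p : unitInterval)
    (hp : (p : ℝ) ≤ c * (n : ℝ) ^ (-(((k : ℝ) - 1) / (2 * (k : ℝ) - 3))))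
    (hm : c * n ≤ ((n / k - A.card : ℕ) : ℝ) / 12) :
    binomialRandom (Fin n) p {G | (squareCycle n).IsContained (completeBipartiteOn A ⊔ G)}
      ≤ ENNReal.ofReal ((1 / 4) ^ (n / k - A.card)) := by
  set m := n / k - A.card
  calc _ ≤ binomialRandom (Fin n) p {G | ∃ S : Finset (Fin k → Fin n), S.card = m ∧
          IsSeparated S ∧ ∀ s ∈ S, ∀ i j, (squarePath k).Adj i j → G.Adj (s i) (s j)} :=
        measure_mono fun G hG => exists_isSeparated_of_isContained A G (by omega) hG
    _ ≤ ((n ^ k).choose m : ENNReal) * (unitInterval.toNNReal p : ENNReal) ^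
          ((squarePath k).edgeSet.ncard * m) := by
        simpa using binomialRandom_exists_isSeparated_le (V := Fin n) (squarePath k) p m
    _ ≤ ((n ^ k).choose m : ENNReal) * (unitInterval.toNNReal p : ENNReal) ^
          ((2 * k - 3) * m) := by
        refine mul_le_mul_right (pow_le_pow_right_of_le_one' ?_
          (Nat.mul_le_mul_right m (le_ncard_edgeSet_squarePath hk))) _
        exact ENNReal.coe_le_one_iff.2 p.2.2
    _ = ENNReal.ofReal (((n ^ k).choose m : ℝ) * (p : ℝ) ^ ((2 * k - 3) * m)) := by
        rw [ENNReal.ofReal_mul (by positivity), ENNReal.ofReal_natCast,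
          ENNReal.ofReal_pow p.2.1]
        congr 2
        rw [ENNReal.ofReal]
        congr 1
        exact NNReal.eq (by simp [p.2.1])
    _ ≤ _ := by
        refine ENNReal.ofReal_le_ofReal ?_
        have hp0 := p.2.1
        calc ((n ^ k).choose m : ℝ) * (p : ℝ) ^ ((2 * k - 3) * m)
            ≤ ((n ^ k : ℕ) : ℝ) ^ m / m.factorial * (p : ℝ) ^ ((2 * k - 3) * m) := by
              gcongr
              exact Nat.choose_le_pow_div m (n ^ k)
          _ = ((n : ℝ) ^ k * (p : ℝ) ^ (2 * k - 3)) ^ m / m.factorial := by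
              rw [mul_pow, pow_mul (p : ℝ)]
              push_cast
              ring
          _ ≤ (1 / 4) ^ m := pow_div_factorial_le (by positivity)
              ((pow_mul_pow_le_of_le_rpow hk hn hc0 hc1 hp0 hp).trans hm)

/-- Rounding n/k and αn costs less than 1 each. -/
theorem le_div_sub_card {k n a : ℕ} {α : ℝ} (hk : 0 < k) (ha : |(a : ℝ) - α * n| < 1) :
    (1 / (k : ℝ) - α) * n - 2 ≤ ((n / k - a : ℕ) : ℝ) := by
  have hk' : (0 : ℝ) < k := by exact_mod_cast hk
  have h1 : ((n / k : ℕ) : ℝ) ≤ ((n / k - a : ℕ) : ℝ) + a := by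
    exact_mod_cast (by omega : n / k ≤ n / k - a + a)
  have h2 : (n : ℝ) / k < ((n / k : ℕ) : ℝ) + 1 := by
    rw [div_lt_iff₀ hk']
    exact_mod_cast (by rw [mul_comm]; exact Nat.lt_mul_div_succ n hk : n < (n / k + 1) * k)
  have h3 := (abs_lt.1 ha).2
  have h4 : (1 / (k : ℝ) - α) * n = n / k - α * n := by ring
  linarith

end PerturbedSquare

open PerturbedSquare in
theorem proposition3p1 (k : ℕ) (hk : 2 ≤ k) (α : ℝ)
    (hα : α ∈ Set.Ioo (1 / ((k : ℝ) + 1)) (1 / (k : ℝ))) :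
    ∃ c : ℝ, 0 < c ∧ c < 1 ∧
      -- classes of sizes `αn` and `(1 - α)n`, where `αn` may be rounded up or down for each `n`
      ∀ A : (n : ℕ) → Finset (Fin n), (∀ n, |((A n).card : ℝ) - α * n| < 1) →
      ∀ p : ℕ → unitInterval,
        (∀ᶠ n : ℕ in atTop,
          (p n : ℝ) ≤ c * (n : ℝ) ^ (-(((k : ℝ) - 1) / (2 * (k : ℝ) - 3)))) →
        Tendsto
          (fun n : ℕ => SimpleGraph.binomialRandom (Fin n) (p n)
            {G | ¬ (PerturbedSquare.squareCycle n).IsContained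
                (PerturbedSquare.completeBipartiteOn (A n) ⊔ G)})
          atTop (𝓝 1) := by
  have hk' : (2 : ℝ) ≤ k := by exact_mod_cast hk
  have hα0 : 0 < α := lt_trans (by positivity) hα.1
  set δ : ℝ := 1 / (k : ℝ) - α with hδ
  have hδ0 : 0 < δ := sub_pos.2 hα.2
  have hδ1 : δ < 1 := by
    have : 1 / (k : ℝ) ≤ 1 := by
      rw [div_le_one (by linarith)]
      linarith
    linarith
  -- Once δn ≥ 4, δn/24 ≤ (δn - 2)/12 ≤ m/12.
  refine ⟨δ / 24, by positivity, by linarith, fun A hA p hp => ?_⟩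
  have hm : ∀ n, δ * n - 2 ≤ ((n / k - (A n).card : ℕ) : ℝ) := fun n =>
    le_div_sub_card (by omega) (hA n)
  have hlin : Tendsto (fun n : ℕ => δ * n - 2) atTop atTop :=
    tendsto_atTop_add_const_right _ _ (tendsto_natCast_atTop_atTop.const_mul_atTop hδ0)
  have hmtop : Tendsto (fun n => n / k - (A n).card) atTop atTop :=
    tendsto_natCast_atTop_iff.1 (tendsto_atTop_mono hm hlin)
  have hbound : Tendsto (fun n => ENNReal.ofReal ((1 / 4 : ℝ) ^ (n / k - (A n).card)))
      atTop (𝓝 0) := by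
    rw [← ENNReal.ofReal_zero]
    exact (ENNReal.continuous_ofReal.tendsto 0).comp
      ((tendsto_pow_atTop_nhds_zero_of_lt_one (by norm_num) (by norm_num)).comp hmtop)
  have hlower : Tendsto (fun n => 1 - ENNReal.ofReal ((1 / 4 : ℝ) ^ (n / k - (A n).card)))
      atTop (𝓝 1) := by
    simpa using ENNReal.Tendsto.sub (tendsto_const_nhds (x := (1 : ENNReal))) hbound
      (Or.inl ENNReal.one_ne_top)
  refine tendsto_of_tendsto_of_tendsto_of_le_of_le' hlower tendsto_const_nhds ?_
    (Eventually.of_forall fun n => prob_le_one)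
  filter_upwards [hp, hlin.eventually_ge_atTop 2, eventually_gt_atTop 0] with n hpn hn2 hn0
  have hcopy := binomialRandom_squareCycle_isContained_le hk hn0 (by positivity) (by linarith)
    (A n) (p n) hpn (by linarith [hm n])
  refine (tsub_le_tsub_left hcopy 1).trans ?_
  rw [tsub_le_iff_right]
  -- Subadditivity bounds the complement without measurability of the event.
  calc (1 : ENNReal) = binomialRandom (Fin n) (p n) Set.univ := measure_univ.symm
    _ ≤ binomialRandom (Fin n) (p n)
        ({G | ¬ (squareCycle n).IsContained (completeBipartiteOn (A n) ⊔ G)} ∪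
          {G | (squareCycle n).IsContained (completeBipartiteOn (A n) ⊔ G)}) :=
        measure_mono fun G _ => (em _).symm
    _ ≤ _ := measure_union_le _ _
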